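/- Index the standard basis $|0\rangle,\dots,|5\rangle$ of $\mathbb{C}^6$ by $\mathbb{Z}_6$, let $\omega=e^{2\pi i/6}$, and let $X,Z$ be the $6\times 6$ matrices with $X|j\rangle=|j+1 \bmod 6\rangle$ and $Z|j\rangle=\omega^{j}|j\rangle$. Let $|\Phi\rangle=\frac{1}{\sqrt6}\sum_{j=0}^{5}|j\rangle\otimes|j\rangle\in\mathbb{C}^6\otimes\mathbb{C}^6$. The generalized Bell states are the $36$ vectors $(I\otimes X^mZ^n)|\Phi\rangle$, $m,n\in\mathbb{Z}_6$, and a 4-GBS set is a set of four distinct generalized Bell states; it is denoted by the set of the corresponding matrices $X^mZ^n$. Two such sets $S,T$ are LU-equivalent if there are unitary $6\times6$ matrices $U_A,U_B$ and a bijection $\sigma:S\to T$ such that for every $\phi\in S$ the vectors $\sigma(\phi)$ and $(U_A\otimes U_B)\phi$ are equal up to a complex factor of modulus $1$. There are $\binom{36}{4}=58905$ 4-GBS sets in $\mathbb{C}^6\otimes\mathbb{C}^6$, and they fall into exactly $31$ LU-equivalence classes. Each 4-GBS set is LU-equivalent to exactly one of the following 4-GBS sets: $\mathcal{C}^{1}=\{I,Z,Z^{2},Z^{3}\}$,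 $\mathcal{C}^{2}=\{I,Z,Z^{2},Z^{4}\}$, $\mathcal{C}^{3}=\{I,Z,Z^{2},X\}$, $\mathcal{C}^{4}=\{I,Z,Z^{2},X^{2}\}$, $\mathcal{C}^{5}=\{I,Z,Z^{2},X^{2}Z\}$, $\mathcal{C}^{6}=\{I,Z,Z^{2},X^{3}\}$, $\mathcal{C}^{7}=\{I,Z,Z^{2},X^{3}Z\}$, $\mathcal{C}^{8}=\{I,Z,Z^{3},Z^{4}\}$, $\mathcal{C}^{9}=\{I,Z,Z^{3},X\}$, $\mathcal{C}^{10}=\{I,Z,Z^{3},X^{2}\}$, $\mathcal{C}^{11}=\{I,Z,Z^{3},X^{2}Z\}$, $\mathcal{C}^{12}=\{I,Z,Z^{3},X^{3}\}$, $\mathcal{C}^{13}=\{I,Z,Z^{3},X^{3}Z\}$, $\mathcal{C}^{14}=\{I,Z,Z^{3},X^{5}\}$, $\mathcal{C}^{15}=\{I,Z,X,XZ\}$, $\mathcal{C}^{16}=\{I,Z,X,XZ^{2}\}$, $\mathcal{C}^{17}=\{I,Z,X,XZ^{3}\}$, $\mathcal{C}^{18}=\{I,Z,X,X^{2}Z^{2}\}$,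 $\mathcal{C}^{19}=\{I,Z,X,X^{3}Z^{5}\}$, $\mathcal{C}^{20}=\{I,Z,X,X^{4}Z^{4}\}$, $\mathcal{C}^{21}=\{I,Z,X^{2},X^{2}Z\}$, $\mathcal{C}^{22}=\{I,Z,X^{2},X^{2}Z^{2}\}$, $\mathcal{C}^{23}=\{I,Z,X^{2},X^{2}Z^{5}\}$, $\mathcal{C}^{24}=\{I,Z,X^{2},X^{3}Z\}$, $\mathcal{C}^{25}=\{I,Z,X^{2},X^{4}\}$, $\mathcal{C}^{26}=\{I,Z,X^{3},X^{3}Z\}$, $\mathcal{C}^{27}=\{I,Z,X^{3},X^{3}Z^{3}\}$, $\mathcal{C}^{28}=\{I,Z,X^{3},X^{3}Z^{5}\}$, $\mathcal{C}^{29}=\{I,Z^{2},Z^{4},X^{2}\}$, $\mathcal{C}^{30}=\{I,Z^{2},X^{2},X^{2}Z^{2}\}$, $\mathcal{C}^{31}=\{I,Z^{3},X^{3},X^{3}Z^{3}\}$. -/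

import Mathlib

open scoped TensorProduct

noncomputable section

namespace GBS

/-- The bipartite system `ℂ^d ⊗ ℂ^d`; the computational basis of `ℂ^d` is indexed by `ℤ/d`. -/
abbrev Bipartite (d : ℕ) : Type := (ZMod d → ℂ) ⊗[ℂ] (ZMod d → ℂ)

/-- The local operation `A ⊗ B` on `ℂ^d ⊗ ℂ^d`. -/
def localOp {d : ℕ} [NeZero d] (A B : Matrix (ZMod d) (ZMod d) ℂ) :
    Bipartite d →ₗ[ℂ] Bipartite d :=
  TensorProduct.map (Matrix.toLin' A) (Matrix.toLin' B)

/-- The shift matrix: `X|j⟩ = |j+1 mod d⟩`. -/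
def shiftX (d : ℕ) [NeZero d] : Matrix (ZMod d) (ZMod d) ℂ :=
  Matrix.of fun i j => if i = j + 1 then 1 else 0

/-- The clock matrix: `Z|j⟩ = ω^j|j⟩` with `ω = exp (2πi/d)`. -/
def clockZ (d : ℕ) [NeZero d] : Matrix (ZMod d) (ZMod d) ℂ :=
  Matrix.diagonal fun j => Complex.exp (2 * Real.pi * Complex.I / d) ^ j.val

/-- The generalized Pauli matrix `X^m Z^n`. -/
def gpm {d : ℕ} [NeZero d] (p : ZMod d × ZMod d) : Matrix (ZMod d) (ZMod d) ℂ :=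
  shiftX d ^ p.1.val * clockZ d ^ p.2.val

/-- The canonical maximally entangled state `(1/√d) ∑ j, |j⟩|j⟩`. -/
def maxEntangled (d : ℕ) [NeZero d] : Bipartite d :=
  ((1 / Real.sqrt d : ℝ) : ℂ) •
    ∑ j : ZMod d, (Pi.single j (1 : ℂ) : ZMod d → ℂ) ⊗ₜ[ℂ] (Pi.single j (1 : ℂ) : ZMod d → ℂ)

/-- The generalized Bell state `(I ⊗ X^m Z^n)|Φ⟩`. -/
def bell {d : ℕ} [NeZero d] (p : ZMod d × ZMod d) : Bipartite d :=
  localOp 1 (gpm p) (maxEntangled d)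

/-- Equality up to a global phase. -/
def PhaseEq {d : ℕ} (φ ψ : Bipartite d) : Prop := ∃ c : ℂ, ‖c‖ = 1 ∧ φ = c • ψ

/-- Local unitary equivalence of two sets of states. -/
def LUEquiv {d : ℕ} [NeZero d] (S T : Set (Bipartite d)) : Prop :=
  ∃ A ∈ Matrix.unitaryGroup (ZMod d) ℂ, ∃ B ∈ Matrix.unitaryGroup (ZMod d) ℂ,
    ∃ σ : S ≃ T, ∀ φ : S, PhaseEq (σ φ : Bipartite d) (localOp A B (φ : Bipartite d))

/-- The sets consisting of `n` generalized Bell states. -/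
def bellSets (d n : ℕ) [NeZero d] : Set (Set (Bipartite d)) :=
  {S | S ⊆ Set.range (bell (d := d)) ∧ S.ncard = n}

theorem localOp_one {d : ℕ} [NeZero d] (φ : Bipartite d) : localOp 1 1 φ = φ := by
  simp [localOp]

theorem localOp_mul {d : ℕ} [NeZero d] (A B A' B' : Matrix (ZMod d) (ZMod d) ℂ)
    (φ : Bipartite d) : localOp (A * A') (B * B') φ = localOp A B (localOp A' B' φ) := by
  simp only [localOp, Matrix.toLin'_mul, TensorProduct.map_comp, LinearMap.comp_apply]

theorem LUEquiv.refl {d : ℕ} [NeZero d] (S : Set (Bipartite d)) : LUEquiv S S :=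
  ⟨1, one_mem _, 1, one_mem _, Equiv.refl _, fun φ => ⟨1, by simp, by simp [localOp_one]⟩⟩

theorem LUEquiv.symm {d : ℕ} [NeZero d] {S T : Set (Bipartite d)} (h : LUEquiv S T) :
    LUEquiv T S := by
  obtain ⟨A, hA, B, hB, σ, h⟩ := h
  refine ⟨star A, Unitary.star_mem hA, star B, Unitary.star_mem hB, σ.symm, fun ψ => ?_⟩
  obtain ⟨c, hc, e⟩ := h (σ.symm ψ)
  have hc0 : c ≠ 0 := by
    rintro rfl
    simp at hc
  refine ⟨c⁻¹, by simp [hc], ?_⟩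
  rw [Equiv.apply_symm_apply] at e
  rw [e, map_smul, ← localOp_mul, Unitary.star_mul_self_of_mem hA,
    Unitary.star_mul_self_of_mem hB, localOp_one, smul_smul, inv_mul_cancel₀ hc0, one_smul]

theorem LUEquiv.trans {d : ℕ} [NeZero d] {S T R : Set (Bipartite d)} (h : LUEquiv S T)
    (h' : LUEquiv T R) : LUEquiv S R := by
  obtain ⟨A, hA, B, hB, σ, h⟩ := h
  obtain ⟨A', hA', B', hB', τ, h'⟩ := h'
  refine ⟨A' * A, mul_mem hA' hA, B' * B, mul_mem hB' hB, σ.trans τ, fun φ => ?_⟩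
  obtain ⟨c, hc, e⟩ := h φ
  obtain ⟨c', hc', e'⟩ := h' (σ φ)
  refine ⟨c' * c, by simp [hc, hc'], ?_⟩
  rw [Equiv.trans_apply, e', e, map_smul, localOp_mul, smul_smul]

/-- Local unitary equivalence as an equivalence relation on the `n`-element sets of
generalized Bell states. -/
def luSetoid (d n : ℕ) [NeZero d] : Setoid (bellSets d n) where
  r S T := LUEquiv (S : Set (Bipartite d)) (T : Set (Bipartite d))
  iseqv := ⟨fun S => LUEquiv.refl (S : Set (Bipartite d)), fun h => LUEquiv.symm h,
    fun h h' => LUEquiv.trans h h'⟩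

/-- The exponents of the 31 representatives; `(m, n)` stands for `X^m Z^n`. -/
def repExponents : Fin 31 → Set (ZMod 6 × ZMod 6) :=
  ![{(0, 0), (0, 1), (0, 2), (0, 3)},
    {(0, 0), (0, 1), (0, 2), (0, 4)},
    {(0, 0), (0, 1), (0, 2), (1, 0)},
    {(0, 0), (0, 1), (0, 2), (2, 0)},
    {(0, 0), (0, 1), (0, 2), (2, 1)},
    {(0, 0), (0, 1), (0, 2), (3, 0)},
    {(0, 0), (0, 1), (0, 2), (3, 1)},
    {(0, 0), (0, 1), (0, 3), (0, 4)},
    {(0, 0), (0, 1), (0, 3), (1, 0)},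
    {(0, 0), (0, 1), (0, 3), (2, 0)},
    {(0, 0), (0, 1), (0, 3), (2, 1)},
    {(0, 0), (0, 1), (0, 3), (3, 0)},
    {(0, 0), (0, 1), (0, 3), (3, 1)},
    {(0, 0), (0, 1), (0, 3), (5, 0)},
    {(0, 0), (0, 1), (1, 0), (1, 1)},
    {(0, 0), (0, 1), (1, 0), (1, 2)},
    {(0, 0), (0, 1), (1, 0), (1, 3)},
    {(0, 0), (0, 1), (1, 0), (2, 2)},
    {(0, 0), (0, 1), (1, 0), (3, 5)},
    {(0, 0), (0, 1), (1, 0), (4, 4)},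
    {(0, 0), (0, 1), (2, 0), (2, 1)},
    {(0, 0), (0, 1), (2, 0), (2, 2)},
    {(0, 0), (0, 1), (2, 0), (2, 5)},
    {(0, 0), (0, 1), (2, 0), (3, 1)},
    {(0, 0), (0, 1), (2, 0), (4, 0)},
    {(0, 0), (0, 1), (3, 0), (3, 1)},
    {(0, 0), (0, 1), (3, 0), (3, 3)},
    {(0, 0), (0, 1), (3, 0), (3, 5)},
    {(0, 0), (0, 2), (0, 4), (2, 0)},
    {(0, 0), (0, 2), (2, 0), (2, 2)},
    {(0, 0), (0, 3), (3, 0), (3, 3)}]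

/-- The 31 representatives as sets of generalized Bell states in `ℂ^6 ⊗ ℂ^6`. -/
def rep (i : Fin 31) : Set (Bipartite 6) := bell '' repExponents i

end GBS

end

/-!
A pair of local unitaries that maps one set of Bell states onto another conjugates the products
`(X^m Z^n)⁻¹ X^m' Z^n'` into each other up to scalars. Conjugation preserves multiplicative orders
and commutation phases, so the orders of the differences of labels `(m, n) ∈ (ℤ/6)²` and the
symplectic form on these differences are invariants of the ordered set. They are complete: modulo
`2` and modulo `3` equality of all of them yields a matrix of determinant one that matches the
differences, by Witt's extension theorem, the two matrices combine to one over `ℤ/6` by the Chinese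
remainder theorem, and every affine map of determinant one is induced by local unitaries, since
translations, transvections and the Fourier transform are. The classification thus reduces to
comparing invariants of finitely many sets, and it suffices to extend representatives of the
`n`-element sets by one point to find those of the `(n + 1)`-element sets.
-/

namespace GBS

/-- Equality of operators up to a nonzero scalar. -/
def Proportional {A : Type*} [Semiring A] [Algebra ℂ A] (x y : A) : Prop :=
  ∃ c : ℂ, c ≠ 0 ∧ x = c • y

local infix:50 " ∝ " => Proportional

namespace Proportional

variable {A : Type*} [Semiring A] [Algebra ℂ A] {x y z x' y' : A}

theorem of_eq (h : x = y) : x ∝ y := ⟨1, one_ne_zero, by rw [h, one_smul]⟩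

theorem symm : x ∝ y → y ∝ x := by
  rintro ⟨c, hc, rfl⟩
  exact ⟨c⁻¹, inv_ne_zero hc, (inv_smul_smul₀ hc y).symm⟩

theorem trans : x ∝ y → y ∝ z → x ∝ z := by
  rintro ⟨c, hc, rfl⟩ ⟨k, hk, rfl⟩
  exact ⟨c * k, mul_ne_zero hc hk, smul_smul c k z⟩

instance : Trans (Proportional (A := A)) (Proportional (A := A)) (Proportional (A := A)) :=
  ⟨trans⟩

theorem mul : x ∝ y → x' ∝ y' → x * x' ∝ y * y' := by
  rintro ⟨c, hc, rfl⟩ ⟨k, hk, rfl⟩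
  exact ⟨c * k, mul_ne_zero hc hk, by rw [smul_mul_smul_comm]⟩

theorem mul_left (z : A) (h : x ∝ y) : z * x ∝ z * y := (of_eq rfl).mul h

theorem mul_right (z : A) (h : x ∝ y) : x * z ∝ y * z := h.mul (of_eq rfl)

theorem of_mul_left (hz : IsUnit z) : z * x ∝ z * y → x ∝ y := by
  rintro ⟨c, hc, h⟩
  exact ⟨c, hc, hz.mul_left_cancel (by rw [h, mul_smul_comm])⟩

theorem of_mul_right (hz : IsUnit z) : x * z ∝ y * z → x ∝ y := by
  rintro ⟨c, hc, h⟩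
  exact ⟨c, hc, hz.mul_right_cancel (by rw [h, smul_mul_assoc])⟩

end Proportional

/-- The phase space `(ℤ/d)²`, whose point `(m, n)` labels the matrix `X^m Z^n`. -/
abbrev PhaseSpace (d : ℕ) : Type := ZMod d × ZMod d

variable {d : ℕ} [NeZero d]

theorem stdAddChar_ne_zero (x : ZMod d) : (ZMod.stdAddChar x : ℂ) ≠ 0 :=
  norm_ne_zero_iff.1 (by simp)

theorem stdAddChar_natCast (n : ℕ) :
    (ZMod.stdAddChar (n : ZMod d) : ℂ) = Complex.exp (2 * Real.pi * Complex.I * n / d) := by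
  exact_mod_cast ZMod.stdAddChar_coe (N := d) n

theorem stdAddChar_pow_val (x k : ZMod d) :
    (ZMod.stdAddChar x : ℂ) ^ k.val = ZMod.stdAddChar (k * x) := by
  rw [← AddChar.map_nsmul_eq_pow, nsmul_eq_mul, ZMod.natCast_zmod_val]

theorem clockZ_eq : clockZ d = Matrix.diagonal fun j : ZMod d => ZMod.stdAddChar j := by
  unfold clockZ
  congr 1
  funext j
  conv_rhs => rw [← ZMod.natCast_zmod_val j, stdAddChar_natCast]
  rw [← Complex.exp_nat_mul]
  congr 1
  ring

theorem shiftX_pow_apply (k : ℕ) (i j : ZMod d) :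
    (shiftX d ^ k) i j = if i = j + k then 1 else 0 := by
  induction k generalizing i j with
  | zero => simp [Matrix.one_apply]
  | succ k ih =>
    have h (l : ZMod d) : shiftX d l j = if l = j + 1 then 1 else 0 := rfl
    simp [pow_succ, Matrix.mul_apply, ih, h, add_assoc, add_comm (1 : ZMod d)]

theorem gpm_apply (p : PhaseSpace d) (i j : ZMod d) :
    gpm p i j = if i = j + p.1 then ZMod.stdAddChar (p.2 * j) else 0 := by
  rw [gpm, clockZ_eq, Matrix.diagonal_pow, Matrix.mul_diagonal, shiftX_pow_apply]
  simp [stdAddChar_pow_val]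

theorem mul_gpm_apply (M : Matrix (ZMod d) (ZMod d) ℂ) (p : PhaseSpace d) (i j : ZMod d) :
    (M * gpm p) i j = M i (j + p.1) * ZMod.stdAddChar (p.2 * j) := by
  simp [Matrix.mul_apply, gpm_apply]

theorem gpm_mul_apply (M : Matrix (ZMod d) (ZMod d) ℂ) (p : PhaseSpace d) (i j : ZMod d) :
    (gpm p * M) i j = ZMod.stdAddChar (p.2 * (i - p.1)) * M (i - p.1) j := by
  simp [Matrix.mul_apply, gpm_apply, ← sub_eq_iff_eq_add]

theorem gpm_zero : gpm (0 : PhaseSpace d) = 1 := by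
  ext i j
  simp [gpm_apply, Matrix.one_apply]

theorem gpm_mul_gpm (p q : PhaseSpace d) :
    gpm p * gpm q = (ZMod.stdAddChar (p.2 * q.1) : ℂ) • gpm (p + q) := by
  ext i j
  rw [mul_gpm_apply, Matrix.smul_apply, smul_eq_mul, gpm_apply, gpm_apply, Prod.fst_add,
    Prod.snd_add, add_assoc, add_comm q.1]
  split_ifs
  · rw [← AddChar.map_add_eq_mul, ← AddChar.map_add_eq_mul]
    ring_nf
  · simp

theorem gpm_mul_gpm_proportional (p q : PhaseSpace d) : gpm p * gpm q ∝ gpm (p + q) :=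
  ⟨_, stdAddChar_ne_zero _, gpm_mul_gpm p q⟩

theorem eq_of_gpm_proportional {p q : PhaseSpace d} : gpm p ∝ gpm q → p = q := by
  rintro ⟨c, -, h⟩
  have entry (j : ZMod d) : ZMod.stdAddChar (p.2 * j)
      = c * if j + p.1 = j + q.1 then (ZMod.stdAddChar (q.2 * j) : ℂ) else 0 := by
    simpa [gpm_apply] using congrFun (congrFun h (j + p.1)) j
  have hfst : p.1 = q.1 := by
    by_contra hne
    simpa [hne] using entry 0
  have hc : c = 1 := by simpa [hfst, eq_comm] using entry 0
  have hsnd : p.2 = q.2 := ZMod.injective_stdAddChar (by simpa [hfst, hc] using entry 1)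
  exact Prod.ext hfst hsnd

theorem gpm_mem_unitaryGroup (p : PhaseSpace d) : gpm p ∈ Matrix.unitaryGroup (ZMod d) ℂ := by
  rw [Matrix.mem_unitaryGroup_iff]
  ext i j
  rw [gpm_mul_apply, Matrix.star_apply, gpm_apply, sub_add_cancel, Matrix.one_apply]
  by_cases h : i = j
  · simp [h, Complex.mul_conj, Complex.normSq_eq_norm_sq]
  · simp [h, Ne.symm h]

theorem isUnit_of_mem_unitaryGroup {U : Matrix (ZMod d) (ZMod d) ℂ}
    (hU : U ∈ Matrix.unitaryGroup (ZMod d) ℂ) : IsUnit U :=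
  (Unitary.toUnits ⟨U, hU⟩).isUnit

theorem isUnit_gpm (p : PhaseSpace d) : IsUnit (gpm p) :=
  isUnit_of_mem_unitaryGroup (gpm_mem_unitaryGroup p)

theorem norm_eq_one_of_smul_mem_unitaryGroup {M : Matrix (ZMod d) (ZMod d) ℂ} {c : ℂ}
    (hM : M ∈ Matrix.unitaryGroup (ZMod d) ℂ) (hcM : c • M ∈ Matrix.unitaryGroup (ZMod d) ℂ) :
    ‖c‖ = 1 := by
  have h : (c * star c) • (1 : Matrix (ZMod d) (ZMod d) ℂ) = 1 := by
    rw [← Matrix.mem_unitaryGroup_iff.1 hM, ← smul_mul_smul_comm, ← star_smul,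
      Matrix.mem_unitaryGroup_iff.1 hcM, Matrix.mem_unitaryGroup_iff.1 hM]
  have hc : c * star c = 1 := by simpa using congrFun (congrFun h 0) 0
  have hnorm : ‖c‖ * ‖c‖ = 1 := by simpa using congrArg norm hc
  exact (mul_self_eq_one_iff.1 hnorm).resolve_right (by linarith [norm_nonneg c])

/-- The coefficient matrix of a bipartite state, whose entry `(i, j)` is the coefficient of
`|j⟩ ⊗ |i⟩`; with this order a local operation on the second factor acts from the left. -/
def coeffMatrix (d : ℕ) [NeZero d] : Bipartite d →ₗ[ℂ] Matrix (ZMod d) (ZMod d) ℂ :=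
  TensorProduct.lift (LinearMap.flip (vecMulVecBilin ℂ ℂ))

theorem coeffMatrix_tmul (x y : ZMod d → ℂ) :
    coeffMatrix d (x ⊗ₜ y) = Matrix.vecMulVec y x := rfl

theorem coeffMatrix_surjective : Function.Surjective (coeffMatrix d) := by
  intro M
  refine ⟨∑ i, ∑ j, M i j • (Pi.single j (1 : ℂ) ⊗ₜ[ℂ] Pi.single i (1 : ℂ)), ?_⟩
  conv_rhs => rw [Matrix.matrix_eq_sum_single M]
  simp only [map_sum, map_smul, coeffMatrix_tmul, ← Matrix.single_eq_single_vecMulVec_single,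
    Matrix.smul_single, smul_eq_mul, mul_one]

theorem coeffMatrix_injective : Function.Injective (coeffMatrix d) := by
  refine (LinearMap.injective_iff_surjective_of_finrank_eq_finrank ?_).2 coeffMatrix_surjective
  rw [Module.finrank_tensorProduct, Module.finrank_matrix, Module.finrank_self, mul_one,
    Module.finrank_fintype_fun_eq_card]

theorem coeffMatrix_localOp (A B : Matrix (ZMod d) (ZMod d) ℂ) (φ : Bipartite d) :
    coeffMatrix d (localOp A B φ) = B * coeffMatrix d φ * A.transpose := by
  induction φ using TensorProduct.induction_on with
  | zero => simp
  | tmul x y =>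
    rw [localOp, TensorProduct.map_tmul, coeffMatrix_tmul, coeffMatrix_tmul, Matrix.toLin'_apply,
      Matrix.toLin'_apply, Matrix.mul_vecMulVec, Matrix.vecMulVec_mul, Matrix.vecMul_transpose]
  | add x y hx hy => simp only [map_add, hx, hy, mul_add, add_mul]

theorem coeffMatrix_maxEntangled :
    coeffMatrix d (maxEntangled d) = ((1 / Real.sqrt d : ℝ) : ℂ) • 1 := by
  rw [maxEntangled, map_smul, map_sum]
  simp only [coeffMatrix_tmul, ← Matrix.single_eq_single_vecMulVec_single]
  rw [Matrix.sum_single_one]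

theorem coeffMatrix_bell (p : PhaseSpace d) :
    coeffMatrix d (bell p) = ((1 / Real.sqrt d : ℝ) : ℂ) • gpm p := by
  rw [bell, coeffMatrix_localOp, coeffMatrix_maxEntangled, Matrix.transpose_one, mul_one,
    mul_smul_comm, mul_one]

theorem bell_eq_smul_localOp_iff (A B : Matrix (ZMod d) (ZMod d) ℂ) (p q : PhaseSpace d) (c : ℂ) :
    bell q = c • localOp A B (bell p) ↔ gpm q = c • (B * gpm p * A.transpose) := by
  have hd : ((1 / Real.sqrt d : ℝ) : ℂ) ≠ 0 := by
    have : (0 : ℝ) < d := Nat.cast_pos.2 (NeZero.pos d)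
    exact Complex.ofReal_ne_zero.2 (by positivity)
  rw [← coeffMatrix_injective.eq_iff, map_smul, coeffMatrix_localOp, coeffMatrix_bell,
    coeffMatrix_bell, mul_smul_comm, smul_mul_assoc, smul_comm]
  exact (smul_right_injective _ hd).eq_iff

theorem bell_injective : Function.Injective (bell (d := d)) := by
  intro p q h
  have h' := (bell_eq_smul_localOp_iff 1 1 q p 1).1 (by rw [localOp_one, h, one_smul])
  exact eq_of_gpm_proportional ⟨1, one_ne_zero, by simpa using h'⟩

theorem phaseEq_bell_localOp_iff {A B : Matrix (ZMod d) (ZMod d) ℂ}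
    (hA : A ∈ Matrix.unitaryGroup (ZMod d) ℂ) (hB : B ∈ Matrix.unitaryGroup (ZMod d) ℂ)
    (p q : PhaseSpace d) :
    PhaseEq (bell q) (localOp A B (bell p)) ↔ gpm q ∝ B * gpm p * A.transpose := by
  simp only [PhaseEq, Proportional, bell_eq_smul_localOp_iff]
  refine exists_congr fun c => and_congr_left fun h => ⟨fun hc => ?_, fun _ => ?_⟩
  · exact norm_ne_zero_iff.1 (hc.trans_ne one_ne_zero)
  · exact norm_eq_one_of_smul_mem_unitaryGroup
      (mul_mem (mul_mem hB (gpm_mem_unitaryGroup p)) (Matrix.transpose_mem_unitaryGroup_iff.2 hA))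
      (h ▸ gpm_mem_unitaryGroup q)

theorem luEquiv_bell_image_iff (S T : Set (PhaseSpace d)) :
    LUEquiv (bell '' S) (bell '' T) ↔
      ∃ U ∈ Matrix.unitaryGroup (ZMod d) ℂ, ∃ V ∈ Matrix.unitaryGroup (ZMod d) ℂ,
        ∃ σ : S ≃ T, ∀ a : S, gpm (σ a : PhaseSpace d) ∝ U * gpm (a : PhaseSpace d) * V := by
  let eS := Equiv.Set.image bell S bell_injective
  let eT := Equiv.Set.image bell T bell_injective
  constructor
  · rintro ⟨A, hA, B, hB, σ, h⟩
    refine ⟨B, hB, A.transpose, Matrix.transpose_mem_unitaryGroup_iff.2 hA,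
      (eS.trans σ).trans eT.symm, fun a => ?_⟩
    rw [← phaseEq_bell_localOp_iff hA hB]
    have := h (eS a)
    rwa [← eT.apply_symm_apply (σ (eS a))] at this
  · rintro ⟨U, hU, V, hV, σ, h⟩
    have hV' := Matrix.transpose_mem_unitaryGroup_iff.2 hV
    refine ⟨V.transpose, hV', U, hU, (eS.symm.trans σ).trans eT, fun φ => ?_⟩
    obtain ⟨a, rfl⟩ := eS.surjective φ
    rw [Equiv.trans_apply, Equiv.trans_apply, Equiv.symm_apply_apply]
    exact (phaseEq_bell_localOp_iff hV' hU _ _).2 (by simpa using h a)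

/-- The standard symplectic form on `R²`, which governs the commutation of the matrices
`X^m Z^n`. -/
def symp {R : Type*} [CommRing R] (v w : R × R) : R := v.1 * w.2 - v.2 * w.1

theorem gpm_mul_gpm_comm (v w : PhaseSpace d) :
    gpm w * gpm v = (ZMod.stdAddChar (symp v w) : ℂ) • (gpm v * gpm w) := by
  rw [gpm_mul_gpm, gpm_mul_gpm, smul_smul, ← AddChar.map_add_eq_mul, add_comm w]
  congr 2
  simp only [symp]
  ring

/-- Conjugation by the operator `U` takes the generalized Pauli matrix of `v` to that of `w`, up
to a scalar; writing it as an intertwining relation avoids the inverse of `U`. -/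
def PauliConj (U : Matrix (ZMod d) (ZMod d) ℂ) (v w : PhaseSpace d) : Prop :=
  U * gpm v ∝ gpm w * U

namespace PauliConj

variable {U V : Matrix (ZMod d) (ZMod d) ℂ} {v w v' w' : PhaseSpace d}

theorem zero (U : Matrix (ZMod d) (ZMod d) ℂ) : PauliConj U 0 0 :=
  .of_eq (by rw [gpm_zero, mul_one, one_mul])

theorem add (h : PauliConj U v w) (h' : PauliConj U v' w') : PauliConj U (v + v') (w + w') :=
  calc
    U * gpm (v + v') ∝ U * (gpm v * gpm v') := (gpm_mul_gpm_proportional v v').symm.mul_left U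
    _ ∝ U * gpm v * gpm v' := .of_eq (mul_assoc _ _ _).symm
    _ ∝ gpm w * U * gpm v' := .mul_right _ h
    _ ∝ gpm w * (U * gpm v') := .of_eq (mul_assoc _ _ _)
    _ ∝ gpm w * (gpm w' * U) := .mul_left _ h'
    _ ∝ gpm w * gpm w' * U := .of_eq (mul_assoc _ _ _).symm
    _ ∝ gpm (w + w') * U := (gpm_mul_gpm_proportional w w').mul_right U

theorem nsmul (h : PauliConj U v w) (n : ℕ) : PauliConj U (n • v) (n • w) := by
  induction n with
  | zero => simpa only [zero_nsmul] using zero U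
  | succ n ih => simpa only [succ_nsmul] using ih.add h

theorem eq_zero_iff (hU : IsUnit U) (h : PauliConj U v w) : v = 0 ↔ w = 0 := by
  constructor
  · rintro rfl
    refine eq_of_gpm_proportional (.of_mul_right hU (.trans h.symm (.of_eq ?_)))
    rw [gpm_zero, mul_one, one_mul]
  · rintro rfl
    refine eq_of_gpm_proportional (.of_mul_left hU (.trans h (.of_eq ?_)))
    rw [gpm_zero, mul_one, one_mul]

theorem addOrderOf_eq (hU : IsUnit U) (h : PauliConj U v w) : addOrderOf v = addOrderOf w :=
  addOrderOf_eq_addOrderOf_iff.2 fun n => (h.nsmul n).eq_zero_iff hU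

theorem symp_eq (hU : IsUnit U) (h : PauliConj U v w) (h' : PauliConj U v' w') :
    symp v v' = symp w w' := by
  obtain ⟨c, hc, h⟩ := h
  obtain ⟨c', hc', h'⟩ := h'
  have push (x y : PhaseSpace d) {x' y' : PhaseSpace d} {k l : ℂ}
      (hx : U * gpm x = k • (gpm x' * U)) (hy : U * gpm y = l • (gpm y' * U)) :
      U * (gpm x * gpm y) = (k * l) • (gpm x' * gpm y' * U) := by
    rw [← mul_assoc, hx, smul_mul_assoc, mul_assoc, hy, mul_smul_comm, smul_smul, mul_assoc]
  have hunit : IsUnit (gpm w * gpm w' * U) := ((isUnit_gpm w).mul (isUnit_gpm w')).mul hU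
  have key : (ZMod.stdAddChar (symp v v') * (c * c') : ℂ) • (gpm w * gpm w' * U)
      = (c * c' * ZMod.stdAddChar (symp w w') : ℂ) • (gpm w * gpm w' * U) := by
    rw [mul_smul, ← push v v' h h', ← mul_smul_comm, ← gpm_mul_gpm_comm, push v' v h' h,
      gpm_mul_gpm_comm, smul_mul_assoc, smul_smul, mul_comm c']
  have hscalar := smul_left_injective ℂ hunit.ne_zero key
  rw [mul_comm] at hscalar
  exact ZMod.injective_stdAddChar (mul_left_cancel₀ (mul_ne_zero hc hc') hscalar)

theorem sub_of_proportional (hV : IsUnit V) (h : gpm w ∝ U * gpm v * V)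
    (h' : gpm w' ∝ U * gpm v' * V) : PauliConj U (v' - v) (w' - w) := by
  refine .of_mul_right (z := gpm v * V) ((isUnit_gpm v).mul hV) ?_
  calc
    U * gpm (v' - v) * (gpm v * V) ∝ U * (gpm (v' - v) * gpm v) * V := .of_eq (by noncomm_ring)
    _ ∝ U * gpm v' * V := by
      simpa only [sub_add_cancel] using
        ((gpm_mul_gpm_proportional (v' - v) v).mul_left U).mul_right V
    _ ∝ gpm w' := h'.symm
    _ ∝ gpm (w' - w) * gpm w := by
      simpa only [sub_add_cancel] using (gpm_mul_gpm_proportional (w' - w) w).symm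
    _ ∝ gpm (w' - w) * (U * gpm v * V) := h.mul_left _
    _ ∝ gpm (w' - w) * U * (gpm v * V) := .of_eq (by noncomm_ring)

end PauliConj

theorem exists_quadratic_phase :
    ∃ θ : ZMod d → ℂ, (∀ j, ‖θ j‖ = 1) ∧
      ∀ j m, θ (j + m) = θ j * θ m * ZMod.stdAddChar (j * m) := by
  have hd0 : (d : ℂ) ≠ 0 := Nat.cast_ne_zero.2 (NeZero.ne d)
  -- The linear term makes the phase `d`-periodic in every dimension, odd or even.
  let e : ℕ → ℂ := fun n => Complex.exp (Real.pi * Complex.I * (n * (n + d)) / d)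
  have hper : Function.Periodic e d := by
    intro n
    simp only [e]
    rw [Complex.exp_eq_exp_iff_exists_int]
    refine ⟨n + d, ?_⟩
    push_cast
    field_simp
    ring
  refine ⟨fun j => e j.val, fun j => ?_, fun j m => ?_⟩
  · have harg : Real.pi * Complex.I * ((j.val : ℂ) * (j.val + d)) / d
        = ((Real.pi * (j.val * (j.val + d)) / d : ℝ) : ℂ) * Complex.I := by
      push_cast
      ring
    simp only [e, harg]
    exact Complex.norm_exp_ofReal_mul_I _
  · have hψ : (ZMod.stdAddChar (j * m) : ℂ)
        = Complex.exp (2 * Real.pi * Complex.I * (j.val * m.val : ℕ) / d) := by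
      rw [← stdAddChar_natCast, Nat.cast_mul, ZMod.natCast_zmod_val, ZMod.natCast_zmod_val]
    change e (j + m).val = e j.val * e m.val * _
    rw [ZMod.val_add, hper.map_mod_nat, hψ]
    simp only [e]
    rw [← Complex.exp_add, ← Complex.exp_add]
    congr 1
    push_cast
    ring

/-- The discrete Fourier transform of `ℂ^d`, with the entries `ω^(kj) / √d`. -/
noncomputable def fourierMatrix (d : ℕ) [NeZero d] : Matrix (ZMod d) (ZMod d) ℂ :=
  Matrix.of fun k j => ((Real.sqrt d)⁻¹ : ℝ) * ZMod.stdAddChar (k * j)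

theorem fourierMatrix_apply (k j : ZMod d) :
    fourierMatrix d k j = ((Real.sqrt d)⁻¹ : ℝ) * ZMod.stdAddChar (k * j) := rfl

theorem fourierMatrix_mem_unitaryGroup : fourierMatrix d ∈ Matrix.unitaryGroup (ZMod d) ℂ := by
  have hd : (0 : ℝ) < d := Nat.cast_pos.2 (NeZero.pos d)
  have hsqrt : (((Real.sqrt d)⁻¹ : ℝ) * ((Real.sqrt d)⁻¹ : ℝ) : ℂ) * d = 1 := by
    have : (Real.sqrt d)⁻¹ * (Real.sqrt d)⁻¹ * d = 1 := by
      rw [← mul_inv, Real.mul_self_sqrt hd.le, inv_mul_cancel₀ hd.ne']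
    exact_mod_cast this
  have hterm (k l j : ZMod d) : fourierMatrix d k j * star (fourierMatrix d l j)
      = ((Real.sqrt d)⁻¹ : ℝ) * ((Real.sqrt d)⁻¹ : ℝ) * ZMod.stdAddChar (j * (k - l)) := by
    have hstar : star (ZMod.stdAddChar (l * j) : ℂ) = ZMod.stdAddChar (-(l * j)) :=
      (AddChar.map_neg_eq_conj _ _).symm
    have hreal : star (((Real.sqrt d)⁻¹ : ℝ) : ℂ) = ((Real.sqrt d)⁻¹ : ℝ) := Complex.conj_ofReal _
    rw [fourierMatrix_apply, fourierMatrix_apply, star_mul', hreal, hstar, mul_mul_mul_comm,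
      ← AddChar.map_add_eq_mul]
    ring_nf
  rw [Matrix.mem_unitaryGroup_iff]
  ext k l
  simp only [Matrix.mul_apply, Matrix.star_apply, hterm]
  rw [← Finset.mul_sum, AddChar.sum_mulShift _ (ZMod.isPrimitive_stdAddChar d), Matrix.one_apply]
  by_cases h : k = l
  · simpa [h] using hsqrt
  · simp [h, sub_eq_zero]

theorem exists_isUnit_add_mul {p q r s : ZMod d} (h : p * s - q * r = 1) :
    ∃ k, IsUnit (q + p * k) := by
  -- Modulo `gcd(p, d)` the entry `q` is a unit, and units lift to units modulo `d`.
  have hdvd : p.val.gcd d ∣ d := Nat.gcd_dvd_right _ _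
  let π := ZMod.castHom hdvd (ZMod (p.val.gcd d))
  have hπ (x : ZMod d) : π x = (x.val : ZMod (p.val.gcd d)) := by
    rw [← map_natCast π, ZMod.natCast_zmod_val]
  have hp : π p = 0 := by
    rw [hπ, ZMod.natCast_eq_zero_iff]
    exact Nat.gcd_dvd_left _ _
  have hq : π q * -π r = 1 := by
    rw [← map_one π, ← h, map_sub, map_mul, map_mul, hp]
    ring
  obtain ⟨u, hu⟩ := ZMod.unitsMap_surjective hdvd (Units.mkOfMulEqOne _ _ hq)
  have hu : π (u - q) = 0 := by
    rw [map_sub, sub_eq_zero]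
    exact congrArg Units.val hu
  rw [hπ, ZMod.natCast_eq_zero_iff] at hu
  obtain ⟨t, ht⟩ := hu
  refine ⟨p⁻¹ * t, ?_⟩
  rw [← mul_assoc, ZMod.mul_inv_eq_gcd, ← Nat.cast_mul, ← ht, ZMod.natCast_zmod_val,
    add_sub_cancel]
  exact u.isUnit

/-- A transformation of the phase space that a pair of local unitaries induces on the
generalized Bell states. -/
def Implementable (g : PhaseSpace d → PhaseSpace d) : Prop :=
  ∃ U ∈ Matrix.unitaryGroup (ZMod d) ℂ, ∃ V ∈ Matrix.unitaryGroup (ZMod d) ℂ,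
    ∀ p, gpm (g p) ∝ U * gpm p * V

namespace Implementable

variable {f g : PhaseSpace d → PhaseSpace d}

theorem comp (hf : Implementable f) (hg : Implementable g) : Implementable (f ∘ g) := by
  obtain ⟨U, hU, V, hV, hf⟩ := hf
  obtain ⟨U', hU', V', hV', hg⟩ := hg
  refine ⟨U * U', mul_mem hU hU', V' * V, mul_mem hV' hV, fun p => ?_⟩
  calc
    gpm (f (g p)) ∝ U * gpm (g p) * V := hf (g p)
    _ ∝ U * (U' * gpm p * V') * V := ((hg p).mul_left U).mul_right V
    _ ∝ U * U' * gpm p * (V' * V) := .of_eq (by noncomm_ring)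

theorem injective (hf : Implementable f) : Function.Injective f := by
  obtain ⟨U, hU, V, hV, h⟩ := hf
  intro p q hpq
  exact eq_of_gpm_proportional <| .of_mul_left (isUnit_of_mem_unitaryGroup hU) <|
    .of_mul_right (isUnit_of_mem_unitaryGroup hV) <| (h p).symm.trans <| hpq ▸ h q

theorem luEquiv (hf : Implementable f) (S : Set (PhaseSpace d)) :
    LUEquiv (bell '' S) (bell '' (f '' S)) := by
  have hinj := hf.injective
  obtain ⟨U, hU, V, hV, h⟩ := hf
  exact (luEquiv_bell_image_iff _ _).2 ⟨U, hU, V, hV, Equiv.Set.image f S hinj, fun a => h a⟩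

theorem of_pauliConj {U : Matrix (ZMod d) (ZMod d) ℂ} (hU : U ∈ Matrix.unitaryGroup (ZMod d) ℂ)
    (h : ∀ p, PauliConj U p (f p)) : Implementable f := by
  refine ⟨U, hU, star U, Unitary.star_mem hU, fun p => ?_⟩
  calc
    gpm (f p) ∝ gpm (f p) * U * star U :=
      .of_eq (by rw [mul_assoc, Unitary.mul_star_self_of_mem hU, mul_one])
    _ ∝ U * gpm p * star U := (h p).symm.mul_right _

theorem add_right (u : PhaseSpace d) : Implementable fun p => p + u := by
  refine ⟨1, one_mem _, gpm u, gpm_mem_unitaryGroup u, fun p => ?_⟩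
  rw [one_mul]
  exact (gpm_mul_gpm_proportional p u).symm

theorem rotation : Implementable fun p : PhaseSpace d => (-p.2, p.1) := by
  refine of_pauliConj fourierMatrix_mem_unitaryGroup fun p =>
    ⟨ZMod.stdAddChar (-(p.1 * p.2)), stdAddChar_ne_zero _, ?_⟩
  ext k j
  rw [mul_gpm_apply, Matrix.smul_apply, gpm_mul_apply, fourierMatrix_apply, fourierMatrix_apply,
    smul_eq_mul, mul_assoc, mul_left_comm _ (((Real.sqrt d)⁻¹ : ℝ) : ℂ),
    mul_left_comm _ (((Real.sqrt d)⁻¹ : ℝ) : ℂ)]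
  simp only [← AddChar.map_add_eq_mul]
  ring_nf

theorem lowerShear (k : ZMod d) : Implementable fun p : PhaseSpace d => (p.1, k * p.1 + p.2) := by
  obtain ⟨θ, hθ, hadd⟩ := exists_quadratic_phase (d := d)
  have hθ0 (j : ZMod d) : θ j ≠ 0 := norm_ne_zero_iff.1 (by simp [hθ])
  let D : Matrix (ZMod d) (ZMod d) ℂ := Matrix.diagonal fun j => θ j ^ k.val
  have hD : D ∈ Matrix.unitaryGroup (ZMod d) ℂ := by
    rw [Matrix.mem_unitaryGroup_iff, Matrix.star_eq_conjTranspose,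
      Matrix.diagonal_conjTranspose, Matrix.diagonal_mul_diagonal, ← Matrix.diagonal_one]
    congr 1
    funext j
    simp [← mul_pow, Complex.mul_conj, Complex.normSq_eq_norm_sq, hθ]
  refine of_pauliConj hD fun p => ⟨θ p.1 ^ k.val, pow_ne_zero _ (hθ0 _), ?_⟩
  ext i j
  rw [Matrix.diagonal_mul, Matrix.smul_apply, Matrix.mul_diagonal, gpm_apply, gpm_apply]
  split_ifs with h
  · rw [h, hadd, mul_pow, mul_pow, stdAddChar_pow_val, add_mul, AddChar.map_add_eq_mul,
      smul_eq_mul]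
    ring_nf
  · simp

theorem upperShear (k : ZMod d) : Implementable fun p : PhaseSpace d => (p.1 + k * p.2, p.2) := by
  convert rotation.comp ((lowerShear (-k)).comp (rotation.comp (rotation.comp rotation))) using 1
  funext p
  simp [add_comm]

theorem linear_of_isUnit {p q r s : ZMod d} (h : p * s - q * r = 1) (hq : IsUnit q) :
    Implementable fun v : PhaseSpace d => (p * v.1 + q * v.2, r * v.1 + s * v.2) := by
  obtain ⟨q', hinv⟩ := hq.exists_right_inv
  convert (lowerShear ((s - 1) * q')).comp ((upperShear q).comp (lowerShear ((p - 1) * q')))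
    using 1
  funext v
  ext <;> simp only [Function.comp_apply]
  · linear_combination (1 - p) * v.1 * hinv
  · linear_combination (-r - (s - 1) * (p - 1) * q') * v.1 * hinv - q' * v.1 * h
      - (s - 1) * v.2 * hinv

theorem linear {p q r s : ZMod d} (h : p * s - q * r = 1) :
    Implementable fun v : PhaseSpace d => (p * v.1 + q * v.2, r * v.1 + s * v.2) := by
  obtain ⟨k, hk⟩ := exists_isUnit_add_mul h
  have h' : p * (s + r * k) - (q + p * k) * r = 1 := by linear_combination h
  convert (linear_of_isUnit h' hk).comp (upperShear (-k)) using 1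
  funext v
  ext <;> simp only [Function.comp_apply] <;> ring

end Implementable

section SymplecticallyEquivalent

variable {R A B K ι : Type*} [CommRing R] [CommRing A] [CommRing B] [Field K]

/-- Two families of vectors of `R²` that correspond under a single matrix of determinant one,
written out as `!![p, q; r, s]`; in the plane these are exactly the symplectic matrices. -/
def SymplecticallyEquivalent (v w : ι → R × R) : Prop :=
  ∃ p q r s : R, p * s - q * r = 1 ∧
    ∀ i, w i = (p * (v i).1 + q * (v i).2, r * (v i).1 + s * (v i).2)

theorem symp_map (f : R →+* A) (v w : R × R) :
    symp (Prod.map f f v) (Prod.map f f w) = f (symp v w) := by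
  simp [symp]

theorem exists_det_one_of_symp_eq {a b a' b' : K × K} (hab : symp a b ≠ 0)
    (h : symp a b = symp a' b') :
    ∃ p q r s : K, p * s - q * r = 1 ∧ ∀ c c', symp a c = symp a' c' → symp c b = symp c' b' →
      c' = (p * c.1 + q * c.2, r * c.1 + s * c.2) := by
  -- The entries are those of the matrix that takes the basis `a, b` to `a', b'`, by Cramer's rule.
  refine ⟨(a'.1 * b.2 - b'.1 * a.2) / symp a b, (b'.1 * a.1 - a'.1 * b.1) / symp a b,
    (a'.2 * b.2 - b'.2 * a.2) / symp a b, (b'.2 * a.1 - a'.2 * b.1) / symp a b,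
    ?_, fun c c' hac hcb => ?_⟩
  · rw [div_mul_div_comm, div_mul_div_comm, ← sub_div, div_eq_one_iff_eq (mul_ne_zero hab hab)]
    simp only [symp] at h ⊢
    linear_combination -(a.1 * b.2 - a.2 * b.1) * h
  · simp only [div_mul_eq_mul_div, ← add_div]
    refine Prod.ext ((eq_div_iff hab).2 ?_) ((eq_div_iff hab).2 ?_) <;>
      simp only [symp] at h hac hcb ⊢
    · linear_combination c'.1 * h - a'.1 * hcb - b'.1 * hac
    · linear_combination c'.2 * h - a'.2 * hcb - b'.2 * hac

theorem exists_symp_eq_one {u : K × K} (hu : u ≠ 0) : ∃ z, symp u z = 1 := by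
  by_cases h : u.1 = 0
  · have h2 : u.2 ≠ 0 := fun h2 => hu (Prod.ext h h2)
    exact ⟨(-u.2⁻¹, 0), by simp [symp, h2]⟩
  · exact ⟨(0, u.1⁻¹), by simp [symp, h]⟩

theorem exists_eq_smul_of_symp_eq_zero {u v : K × K} (hu : u ≠ 0) (h : symp u v = 0) :
    ∃ t : K, v = t • u := by
  obtain ⟨z, hz⟩ := exists_symp_eq_one hu
  simp only [symp] at h hz
  refine ⟨symp v z, Prod.ext ?_ ?_⟩ <;> simp only [symp, Prod.smul_fst, Prod.smul_snd, smul_eq_mul]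
  · linear_combination -v.1 * hz + z.1 * h
  · linear_combination -v.2 * hz + z.2 * h

theorem symplecticallyEquivalent_smul {a a' : K × K} (ha : a ≠ 0) (ha' : a' ≠ 0) (t : ι → K) :
    SymplecticallyEquivalent (fun i => t i • a) fun i => t i • a' := by
  obtain ⟨b, hb⟩ := exists_symp_eq_one ha
  obtain ⟨b', hb'⟩ := exists_symp_eq_one ha'
  obtain ⟨p, q, r, s, hdet, h⟩ :=
    exists_det_one_of_symp_eq (hb.trans_ne one_ne_zero) (hb.trans hb'.symm)
  refine ⟨p, q, r, s, hdet, fun i => h _ _ ?_ ?_⟩ <;> simp only [symp] at hb hb' ⊢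
  · simp only [Prod.smul_fst, Prod.smul_snd, smul_eq_mul]
    ring
  · simp only [Prod.smul_fst, Prod.smul_snd, smul_eq_mul]
    linear_combination t i * (hb - hb')

theorem symplecticallyEquivalent_of_symp_eq (hK : ∀ t : K, t = 0 ∨ t = 1 ∨ t = -1)
    {v w : ι → K × K} (hsymp : ∀ i j, symp (v i) (v j) = symp (w i) (w j))
    (hzero : ∀ i, v i = 0 ↔ w i = 0) (heq : ∀ i j, v i = v j ↔ w i = w j) :
    SymplecticallyEquivalent v w := by
  by_cases hspan : ∃ i j, symp (v i) (v j) ≠ 0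
  · obtain ⟨i, j, hij⟩ := hspan
    obtain ⟨p, q, r, s, hdet, h⟩ := exists_det_one_of_symp_eq hij (hsymp i j)
    exact ⟨p, q, r, s, hdet, fun k => h _ _ (hsymp i k) (hsymp k j)⟩
  push Not at hspan
  by_cases hv : ∃ i, v i ≠ 0
  · obtain ⟨o, ho⟩ := hv
    have ho' : w o ≠ 0 := (hzero o).not.1 ho
    choose t ht using fun i => exists_eq_smul_of_symp_eq_zero ho (hspan o i)
    choose t' ht' using fun i => exists_eq_smul_of_symp_eq_zero ho' (hsymp o i ▸ hspan o i)
    -- Over `𝔽₂` and `𝔽₃`, knowing whether a scalar is `0` and whether it is `1` determines it.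
    have htt' (i : ι) : t' i = t i := by
      have h0 : t i = 0 ↔ t' i = 0 := by simpa [ht i, ht' i, ho, ho'] using hzero i
      have h1 : t i = 1 ↔ t' i = 1 := by
        rw [← (smul_left_injective K ho).eq_iff, ← (smul_left_injective K ho').eq_iff]
        simpa only [one_smul, ← ht, ← ht'] using heq i o
      have := hK (t i)
      have := hK (t' i)
      grind
    rw [funext ht, funext ht', funext htt']
    exact symplecticallyEquivalent_smul ho ho' t
  · push Not at hv
    exact ⟨1, 0, 0, 1, by ring, fun i => by simp [hv i, (hzero i).1 (hv i), Prod.ext_iff]⟩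

theorem symplecticallyEquivalent_of_ringHom {f : R →+* A} {g : R →+* B}
    (hfg : Function.Bijective (f.prod g)) {v w : ι → R × R}
    (hA : SymplecticallyEquivalent (fun i => Prod.map f f (v i)) fun i => Prod.map f f (w i))
    (hB : SymplecticallyEquivalent (fun i => Prod.map g g (v i)) fun i => Prod.map g g (w i)) :
    SymplecticallyEquivalent v w := by
  obtain ⟨p, q, r, s, hdet, hA⟩ := hA
  obtain ⟨p', q', r', s', hdet', hB⟩ := hB
  obtain ⟨P, hP⟩ := hfg.surjective (p, p')
  obtain ⟨Q, hQ⟩ := hfg.surjective (q, q')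
  obtain ⟨M, hM⟩ := hfg.surjective (r, r')
  obtain ⟨S, hS⟩ := hfg.surjective (s, s')
  simp only [RingHom.prod_apply, Prod.ext_iff, Prod.map_fst, Prod.map_snd] at hP hQ hM hS hA hB
  refine ⟨P, Q, M, S, hfg.injective ?_, fun i => Prod.ext (hfg.injective ?_) (hfg.injective ?_)⟩ <;>
    simp only [RingHom.prod_apply, map_sub, map_add, map_mul, map_one, Prod.ext_iff, Prod.fst_one,
      Prod.snd_one, hP, hQ, hM, hS]
  · exact ⟨hdet, hdet'⟩
  · exact ⟨(hA i).1, (hB i).1⟩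
  · exact ⟨(hA i).2, (hB i).2⟩

theorem symplecticallyEquivalent_map {n : ℕ} {f : R →+* K}
    (hK : ∀ t : K, t = 0 ∨ t = 1 ∨ t = -1) (hf : ∀ v, Prod.map f f v = 0 ↔ n • v = 0)
    {x y : ι → R × R} (o : ι)
    (horder : ∀ i j, addOrderOf (x j - x i) = addOrderOf (y j - y i))
    (hsymp : ∀ i j, symp (x i - x o) (x j - x o) = symp (y i - y o) (y j - y o)) :
    SymplecticallyEquivalent (fun i => Prod.map f f (x i - x o))
      fun i => Prod.map f f (y i - y o) := by
  have hzero (i j : ι) : Prod.map f f (x j - x i) = 0 ↔ Prod.map f f (y j - y i) = 0 := by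
    rw [hf, hf, ← addOrderOf_dvd_iff_nsmul_eq_zero, horder, addOrderOf_dvd_iff_nsmul_eq_zero]
  have heq (z : ι → R × R) (i j : ι) : Prod.map f f (z i - z o) = Prod.map f f (z j - z o) ↔
      Prod.map f f (z i - z j) = 0 := by
    simp [Prod.ext_iff, sub_eq_zero]
  refine symplecticallyEquivalent_of_symp_eq hK (fun i j => ?_) (hzero o) fun i j => ?_
  · rw [symp_map, symp_map, hsymp]
  · rw [heq, heq, hzero]

end SymplecticallyEquivalent

theorem symplecticallyEquivalent_of_addOrderOf_eq {ι : Type*} {x y : ι → PhaseSpace 6} (o : ι)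
    (horder : ∀ i j, addOrderOf (x j - x i) = addOrderOf (y j - y i))
    (hsymp : ∀ i j, symp (x i - x o) (x j - x o) = symp (y i - y o) (y j - y o)) :
    SymplecticallyEquivalent (fun i => x i - x o) fun i => y i - y o := by
  have crt : Function.Bijective ((ZMod.castHom (by decide : 2 ∣ 6) (ZMod 2)).prod
      (ZMod.castHom (by decide : 3 ∣ 6) (ZMod 3))) :=
    (Fintype.bijective_iff_injective_and_card _).2 ⟨by decide, by decide⟩
  exact symplecticallyEquivalent_of_ringHom crt
    (symplecticallyEquivalent_map (n := 3) (by decide) (by decide) o horder hsymp)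
    (symplecticallyEquivalent_map (n := 2) (by decide) (by decide) o horder hsymp)

/-- The additive order of a point of the phase space, as a formula that can be evaluated. -/
def order (v : PhaseSpace d) : ℕ := (d / d.gcd v.1.val).lcm (d / d.gcd v.2.val)

theorem addOrderOf_eq_order (v : PhaseSpace d) : addOrderOf v = order v := by
  have h (x : ZMod d) : addOrderOf x = d / d.gcd x.val := by
    conv_lhs => rw [← ZMod.natCast_zmod_val x, ZMod.addOrderOf_coe _ (NeZero.ne d)]
  rw [order, ← h, ← h, ← Prod.addOrderOf_mk]

/-- The numerical invariants of a list of points of the phase space: the orders of the differences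
and the Gram matrix of the symplectic form, with the first point of the list as the origin. -/
def invariants : List (PhaseSpace d) → List (List (ℕ × ℕ))
  | [] => []
  | o :: l => (o :: l).map fun a => (o :: l).map fun b =>
      (order (b - a), (symp (a - o) (b - o)).val)

omit [NeZero d] in
theorem length_invariants (l : List (PhaseSpace d)) : (invariants l).length = l.length := by
  cases l <;> simp [invariants]

theorem invariants_map_eq {α : Type*} {x y : α → PhaseSpace d}
    (horder : ∀ i j, addOrderOf (x j - x i) = addOrderOf (y j - y i))
    (hsymp : ∀ o i j, symp (x i - x o) (x j - x o) = symp (y i - y o) (y j - y o)) (l : List α) :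
    invariants (l.map x) = invariants (l.map y) := by
  cases l <;> simp [invariants, ← addOrderOf_eq_order, horder, hsymp, -sub_self]

theorem invariants_eq_of_luEquiv {l l' : List (PhaseSpace d)} (hl : l.Nodup) (hl' : l'.Nodup)
    (h : LUEquiv (bell '' {p | p ∈ l}) (bell '' {p | p ∈ l'})) :
    ∃ m, m.Perm l' ∧ invariants l = invariants m := by
  obtain ⟨U, hU, V, hV, σ, hσ⟩ := (luEquiv_bell_image_iff _ _).1 h
  have hconj (a b : {p | p ∈ l}) : PauliConj U (b - a) (σ b - σ a) :=
    PauliConj.sub_of_proportional (isUnit_of_mem_unitaryGroup hV) (hσ a) (hσ b)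
  refine ⟨l.attach.map fun a => σ a, ?_, ?_⟩
  · refine (List.perm_ext_iff_of_nodup
      (hl.attach.map (Subtype.val_injective.comp σ.injective)) hl').2 fun b => ?_
    rw [List.mem_map]
    exact ⟨fun ⟨a, _, hab⟩ => hab ▸ (σ a).2,
      fun hb => ⟨σ.symm ⟨b, hb⟩, List.mem_attach _ _, by simp⟩⟩
  · conv_lhs => rw [← l.attach_map_subtype_val]
    exact invariants_map_eq (fun i j => (hconj i j).addOrderOf_eq (isUnit_of_mem_unitaryGroup hU))
      (fun o i j => (hconj o i).symp_eq (isUnit_of_mem_unitaryGroup hU) (hconj o j)) _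

theorem exists_implementable_map_eq {l l' : List (PhaseSpace 6)}
    (h : invariants l = invariants l') : ∃ g, Implementable g ∧ l.map g = l' := by
  have hl : l.length = l'.length := by rw [← length_invariants, h, length_invariants]
  rcases l with _ | ⟨a, l⟩ <;> rcases l' with _ | ⟨b, l'⟩
  · exact ⟨_, .add_right 0, rfl⟩
  · simp at hl
  · simp at hl
  let x (i : Fin (l.length + 1)) : PhaseSpace 6 := (a :: l)[i]
  let y (i : Fin (l.length + 1)) : PhaseSpace 6 := (b :: l')[i]'(hl ▸ i.2)
  have hentry (i j) : order (x j - x i) = order (y j - y i) ∧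
      symp (x i - x 0) (x j - x 0) = symp (y i - y 0) (y j - y 0) := by
    have hi := i.2
    have hj := j.2
    have := congrArg (fun m => m[(i : ℕ)]?.bind (·[(j : ℕ)]?)) h
    simpa [invariants, -List.map_cons, (ZMod.val_injective 6).eq_iff, hi, hj, ← hl, x, y]
      using this
  obtain ⟨p, q, r, s, hdet, hmap⟩ := symplecticallyEquivalent_of_addOrderOf_eq (x := x) (y := y) 0
    (fun i j => by simpa only [addOrderOf_eq_order] using (hentry i j).1)
    fun i j => (hentry i j).2
  refine ⟨_, (Implementable.add_right b).comp ((Implementable.linear hdet).comp (.add_right (-a))),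
    List.ext_getElem (by simpa using hl) fun i hi hi' => ?_⟩
  rw [List.getElem_map, Function.comp_apply, Function.comp_apply, ← sub_eq_add_neg]
  exact (sub_eq_iff_eq_add.1 (hmap ⟨i, by simpa using hi⟩)).symm

/-- The invariants packed into a single number, since the kernel compares numbers faster than
lists. -/
def signature (l : List (PhaseSpace d)) : ℕ := Encodable.encode (invariants l)

/-- The signatures of all the orderings of a list of points, which no longer depend on a choice of
the origin. -/
def signatures (l : List (PhaseSpace d)) : List ℕ := l.permutations'.map signature

omit [NeZero d] in
theorem signature_mem_signatures_iff {l l' : List (PhaseSpace d)} :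
    signature l ∈ signatures l' ↔ ∃ m, m.Perm l' ∧ invariants l = invariants m := by
  simp only [signatures, signature, List.mem_map, List.mem_permutations', Encodable.encode_inj,
    eq_comm]

theorem signature_mem_of_luEquiv {l l' : List (PhaseSpace d)} (hl : l.Nodup) (hl' : l'.Nodup)
    (h : LUEquiv (bell '' {p | p ∈ l}) (bell '' {p | p ∈ l'})) : signature l ∈ signatures l' :=
  signature_mem_signatures_iff.2 (invariants_eq_of_luEquiv hl hl' h)

theorem exists_implementable_image_eq {l l' : List (PhaseSpace 6)}
    (h : signature l ∈ signatures l') :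
    ∃ g, Implementable g ∧ g '' {p | p ∈ l} = {p | p ∈ l'} := by
  obtain ⟨m, hm, hlm⟩ := signature_mem_signatures_iff.1 h
  obtain ⟨g, hg, hgm⟩ := exists_implementable_map_eq hlm
  refine ⟨g, hg, ?_⟩
  ext p
  simp [← hm.mem_iff, ← hgm]

/-- Implementable transformations take every set of `n` points to one of those listed in `R`. -/
def Covers (n : ℕ) (R : List (List (PhaseSpace d))) : Prop :=
  ∀ S : Set (PhaseSpace d), S.ncard = n → ∃ g, Implementable g ∧ ∃ r ∈ R, g '' S = {p | p ∈ r}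

theorem Covers.zero : Covers 0 [([] : List (PhaseSpace d))] := by
  intro S hS
  exact ⟨_, .add_right 0, [], by simp, by simp [(Set.ncard_eq_zero).1 hS]⟩

theorem Covers.succ {n : ℕ} {R R' : List (List (PhaseSpace 6))} (hR : Covers n R)
    (h : ∀ r ∈ R, ∀ p, p ∉ r → ∃ r' ∈ R', signature (r ++ [p]) ∈ signatures r') :
    Covers (n + 1) R' := by
  intro S hS
  obtain ⟨a, T, haT, rfl, hT⟩ := Set.eq_insert_of_ncard_eq_succ hS
  obtain ⟨g, hg, r, hrR, hr⟩ := hR T hT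
  have har : g a ∉ r := fun hmem =>
    haT (hg.injective.mem_set_image.1 (hr.symm ▸ hmem))
  obtain ⟨r', hr'R, hsignature⟩ := h r hrR (g a) har
  obtain ⟨f, hf, hfr⟩ := exists_implementable_image_eq hsignature
  refine ⟨f ∘ g, hf.comp hg, r', hr'R, ?_⟩
  rw [Set.image_comp, Set.image_insert_eq, hr, ← hfr]
  congr 1
  ext p
  simp [or_comm]

/-- Representatives of the two-element subsets of the phase space. -/
def pairs : List (List (PhaseSpace 6)) :=
  [[(0, 0), (0, 1)], [(0, 0), (0, 2)], [(0, 0), (0, 3)]]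

/-- Representatives of the three-element subsets of the phase space. -/
def triples : List (List (PhaseSpace 6)) :=
  [[(0, 0), (0, 1), (0, 2)], [(0, 0), (0, 1), (0, 3)], [(0, 0), (0, 1), (1, 0)],
    [(0, 0), (0, 1), (2, 0)], [(0, 0), (0, 1), (3, 0)], [(0, 0), (0, 1), (3, 2)],
    [(0, 0), (0, 2), (0, 4)], [(0, 0), (0, 2), (2, 0)], [(0, 0), (0, 3), (3, 0)]]

/-- The representatives of `repExponents`, as lists. -/
def quadruples : List (List (PhaseSpace 6)) :=
  [[(0, 0), (0, 1), (0, 2), (0, 3)],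
    [(0, 0), (0, 1), (0, 2), (0, 4)],
    [(0, 0), (0, 1), (0, 2), (1, 0)],
    [(0, 0), (0, 1), (0, 2), (2, 0)],
    [(0, 0), (0, 1), (0, 2), (2, 1)],
    [(0, 0), (0, 1), (0, 2), (3, 0)],
    [(0, 0), (0, 1), (0, 2), (3, 1)],
    [(0, 0), (0, 1), (0, 3), (0, 4)],
    [(0, 0), (0, 1), (0, 3), (1, 0)],
    [(0, 0), (0, 1), (0, 3), (2, 0)],
    [(0, 0), (0, 1), (0, 3), (2, 1)],
    [(0, 0), (0, 1), (0, 3), (3, 0)],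
    [(0, 0), (0, 1), (0, 3), (3, 1)],
    [(0, 0), (0, 1), (0, 3), (5, 0)],
    [(0, 0), (0, 1), (1, 0), (1, 1)],
    [(0, 0), (0, 1), (1, 0), (1, 2)],
    [(0, 0), (0, 1), (1, 0), (1, 3)],
    [(0, 0), (0, 1), (1, 0), (2, 2)],
    [(0, 0), (0, 1), (1, 0), (3, 5)],
    [(0, 0), (0, 1), (1, 0), (4, 4)],
    [(0, 0), (0, 1), (2, 0), (2, 1)],
    [(0, 0), (0, 1), (2, 0), (2, 2)],
    [(0, 0), (0, 1), (2, 0), (2, 5)],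
    [(0, 0), (0, 1), (2, 0), (3, 1)],
    [(0, 0), (0, 1), (2, 0), (4, 0)],
    [(0, 0), (0, 1), (3, 0), (3, 1)],
    [(0, 0), (0, 1), (3, 0), (3, 3)],
    [(0, 0), (0, 1), (3, 0), (3, 5)],
    [(0, 0), (0, 2), (0, 4), (2, 0)],
    [(0, 0), (0, 2), (2, 0), (2, 2)],
    [(0, 0), (0, 3), (3, 0), (3, 3)]]

set_option maxRecDepth 10000 in
theorem covers_quadruples : Covers 4 quadruples := by
  have covers_singleton : Covers 1 [[0]] := Covers.zero.succ (by decide +kernel)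
  have covers_pairs : Covers 2 pairs := covers_singleton.succ (by decide +kernel)
  have covers_triples : Covers 3 triples := covers_pairs.succ (by decide +kernel)
  exact covers_triples.succ (by decide +kernel)

theorem eq_of_signature_mem_signatures :
    ∀ i j : Fin 31, signature (quadruples.get i) ∈ signatures (quadruples.get j) → i = j := by
  decide +kernel

theorem nodup_quadruples (i : Fin 31) : (quadruples.get i).Nodup := by
  have hnodup : ∀ l ∈ quadruples, l.Nodup := by decide
  exact hnodup _ (List.get_mem _ _)

theorem length_quadruples : ∀ i : Fin 31, (quadruples.get i).length = 4 := by
  decide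

theorem repExponents_eq (i : Fin 31) : repExponents i = {p | p ∈ quadruples.get i} := by
  have setOf_mem (a b c e : PhaseSpace 6) : {a, b, c, e} = {p | p ∈ [a, b, c, e]} := by
    ext p
    simp
  fin_cases i <;> exact setOf_mem _ _ _ _

theorem ncard_bellSets (n : ℕ) : (bellSets d n).ncard = (d * d).choose n := by
  have hrange : (Set.range (bell (d := d))).ncard = d * d := by
    rw [← Set.image_univ, Set.ncard_image_of_injective _ bell_injective, Set.ncard_univ,
      Nat.card_prod, Nat.card_zmod]
  rw [← hrange]
  exact Set.ncard_powerset_ncard (Set.finite_range bell) n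

theorem rep_mem_bellSets (i : Fin 31) : rep i ∈ bellSets 6 4 := by
  refine ⟨Set.image_subset_range _ _, ?_⟩
  rw [rep, Set.ncard_image_of_injective _ bell_injective, repExponents_eq, ← List.coe_toFinset,
    Set.ncard_coe_finset, List.toFinset_card_of_nodup (nodup_quadruples i), length_quadruples]

theorem rep_luEquiv_injective {i j : Fin 31} (h : LUEquiv (rep i) (rep j)) : i = j := by
  rw [rep, rep, repExponents_eq, repExponents_eq] at h
  exact eq_of_signature_mem_signatures i j
    (signature_mem_of_luEquiv (nodup_quadruples i) (nodup_quadruples j) h)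

theorem exists_luEquiv_rep {S : Set (Bipartite 6)} (hS : S ∈ bellSets 6 4) :
    ∃ i, LUEquiv S (rep i) := by
  obtain ⟨hrange, hncard⟩ := hS
  obtain ⟨T, rfl⟩ := Set.subset_range_iff_exists_image_eq.1 hrange
  rw [Set.ncard_image_of_injective _ bell_injective] at hncard
  obtain ⟨g, hg, r, hr, hgT⟩ := covers_quadruples T hncard
  obtain ⟨i, rfl⟩ : ∃ i : Fin 31, quadruples.get i = r := List.get_of_mem hr
  refine ⟨i, ?_⟩
  rw [rep, repExponents_eq, ← hgT]
  exact hg.luEquiv T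

theorem existsUnique_luEquiv_rep {S : Set (Bipartite 6)} (hS : S ∈ bellSets 6 4) :
    ∃! i : Fin 31, LUEquiv S (rep i) := by
  obtain ⟨i, hi⟩ := exists_luEquiv_rep hS
  exact ⟨i, hi, fun j hj => rep_luEquiv_injective (hj.symm.trans hi)⟩

theorem card_quotient_luSetoid : Nat.card (Quotient (luSetoid 6 4)) = 31 := by
  let f (i : Fin 31) : Quotient (luSetoid 6 4) := ⟦⟨rep i, rep_mem_bellSets i⟩⟧
  have hf : Function.Bijective f := by
    refine ⟨fun i j h => rep_luEquiv_injective (Quotient.exact h), Quotient.ind fun S => ?_⟩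
    obtain ⟨i, hi⟩ := exists_luEquiv_rep S.2
    exact ⟨i, Quotient.sound hi.symm⟩
  rw [← Nat.card_eq_of_bijective f hf, Nat.card_fin]

end GBS

theorem mainTheorem2 :
    (GBS.bellSets 6 4).ncard = 58905 ∧
    Nat.card (Quotient (GBS.luSetoid 6 4)) = 31 ∧
    (∀ i : Fin 31, GBS.rep i ∈ GBS.bellSets 6 4) ∧
    (∀ S ∈ GBS.bellSets 6 4, ∃! i : Fin 31, GBS.LUEquiv S (GBS.rep i)) :=
  ⟨(GBS.ncard_bellSets 4).trans (by decide), GBS.card_quotient_luSetoid, GBS.rep_mem_bellSets,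
    fun _ hS => GBS.existsUnique_luEquiv_rep hS⟩
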